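/- Let $K>0$, $N\in(1,\infty)$ and $0<D\le D_{K,N}$, where $D_{K,N}:=\pi/\sqrt{K/(N-1)}$ for $K>0$ and $D_{K,N}:=+\infty$ for $K\le 0$. For $\kappa\ge 0$ put $s_\kappa(\theta)=\frac{1}{\sqrt\kappa}\sin(\sqrt\kappa\,\theta)$ if $\kappa>0$ and $s_0(\theta)=\theta$. For $K'\ge 0$ and $0<D\le D_{K',N}$, let $h_{K',N,D}:\mathbb R\to[0,\infty)$ be the density $$h_{K',N,D}(x)=\begin{cases} s_{K'/(N-1)}(D-x)^{N-1}, & x\in[0,D/2],\\ s_{K'/(N-1)}(x)^{N-1}, & x\in[D/2,D],\\ 0,& x\notin[0,D],\end{cases}$$ and let $$\sigma_{K',N-1}^{(t)}(\theta)=\begin{cases}+\infty, & \theta\ge D_{K',N},\\ \dfrac{s_{K'/(N-1)}(t\theta)}{s_{K'/(N-1)}(\theta)}, & 0<\theta<D_{K',N}.\end{cases}$$ For a density $h\ge 0$ on $\mathbb R$, let $\lambda[h]\in[0,\infty]$ be its Poincaré constant $$\lambda[h]=\inf\left\{\frac{\int_{\mathbb R}|\nabla f|^2\,h\,dx}{\int_{\mathbb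 R} f^2\,h\,dx}\ :\ f:\mathbb R\to\mathbb R \text{ locally Lipschitz},\ f\in L^1(h\,dx),\ \int_{\mathbb R} f\,h\,dx=0,\ 0<\int_{\mathbb R} f^2\,h\,dx<\infty\right\},$$ where $|\nabla f|(x)=\limsup_{y\to x,\,y\ne x}\frac{|f(y)-f(x)|}{|y-x|}$. Then $$\lambda[h_{0,N,D}]\ \le\ \lambda[h_{K,N,D}]\ \le\ \lambda[h_{0,N,D}]\left(\frac{\sigma_{K,N-1}^{(1/2)}(D)}{\sigma_{0,N-1}^{(1/2)}(D)}\right)^{N-1}=\ \lambda[h_{0,N,D}]\left(\frac{2\sin\left(\sqrt{\frac{K}{N-1}}\,\frac D2\right)}{\sin\left(\sqrt{\frac{K}{N-1}}\,D\right)}\right)^{N-1},$$ where for $D=D_{K,N}$ (when the last denominator vanishes) the last two expressions are read as $+\infty$. -/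

import Mathlib

open MeasureTheory Filter Topology
open scoped ENNReal

noncomputable section

/-- The local Lipschitz constant `|∇f|(x) = limsup_{y → x, y ≠ x} |f(y) - f(x)| / d(y, x)`.
At an isolated point the punctured neighbourhood filter is trivial and the value is `0`. -/
def localLipschitzConstant {X : Type*} [MetricSpace X] (f : X → ℝ) (x : X) : ℝ≥0∞ :=
  limsup (fun y => edist (f y) (f x) / edist y x) (𝓝[≠] x)

/-- Test functions for the Poincaré constant of `(X, d, m)`: locally Lipschitz functions with
zero mean and with `0 < ∫ f² dm < ∞`. -/
def IsPoincareTest {X : Type*} [MetricSpace X] [MeasurableSpace X]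
    (m : Measure X) (f : X → ℝ) : Prop :=
  LocallyLipschitz f ∧ Integrable f m ∧ ∫ x, f x ∂m = 0 ∧
    0 < ∫⁻ x, ENNReal.ofReal (f x ^ 2) ∂m ∧ ∫⁻ x, ENNReal.ofReal (f x ^ 2) ∂m < ∞

/-- The Poincaré constant of `(X, d, m)`: the infimum over all test functions of
`∫ |∇f|² dm / ∫ f² dm`, as an element of `[0, ∞]`. -/
def poincareConstant {X : Type*} [MetricSpace X] [MeasurableSpace X] (m : Measure X) : ℝ≥0∞ :=
  ⨅ (f : X → ℝ) (_ : IsPoincareTest m f),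
    (∫⁻ x, localLipschitzConstant f x ^ 2 ∂m) / ∫⁻ x, ENNReal.ofReal (f x ^ 2) ∂m

/-- `λ[h]`, the Poincaré constant of `(ℝ, |·|, h dx)`. -/
def densityPoincareConstant (h : ℝ → ℝ) : ℝ≥0∞ :=
  poincareConstant ((volume : Measure ℝ).withDensity fun x => ENNReal.ofReal (h x))

/-- The function `s_κ`. -/
def sKappa (κ θ : ℝ) : ℝ :=
  if 0 < κ then 1 / √κ * Real.sin (√κ * θ)
  else if κ = 0 then θ
  else 1 / √(-κ) * Real.sinh (√(-κ) * θ)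

/-- The Bonnet–Myers diameter bound `D_{K,N}`. -/
def bonnetMyersDiam (K N : ℝ) : EReal :=
  if 0 < K then ((Real.pi / √(K / (N - 1)) : ℝ) : EReal) else ⊤

/-- The distortion coefficient with parameters `K`, `N - 1`, at `t ∈ [0, 1]` and `θ > 0`:
`s_κ(tθ) / s_κ(θ)` with `κ = K / (N - 1)` if `θ < D_{K,N}`, and `+∞` if `θ ≥ D_{K,N}`. -/
def distortionCoeff (K N t θ : ℝ) : ℝ≥0∞ :=
  open Classical in
  if bonnetMyersDiam K N ≤ (θ : EReal) then ∞
  else ENNReal.ofReal (sKappa (K / (N - 1)) (t * θ) / sKappa (K / (N - 1)) θ)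

/-- The model density `h_{K,N,D}`, supported on `[0, D]`. -/
def modelDensity (K N D x : ℝ) : ℝ :=
  open Classical in
  if x ∈ Set.Icc 0 (D / 2) then sKappa (K / (N - 1)) (D - x) ^ (N - 1)
  else if x ∈ Set.Icc (D / 2) D then sKappa (K / (N - 1)) x ^ (N - 1)
  else 0

end

/-! On `[0, D]` write h_K = h_0 · r with r(x) = (s_κ(m)/m)^(N-1), where κ = K/(N-1) and m = max(x,
D-x). Since sin is concave on [0, π], sin u / u decreases on (0, π]; hence r is symmetric about D/2
and decreases away from it. Both bounds follow from this.

Upper bound: for D < D_{K,N}, r lies between its positive values at m = D and m = D/2. Bounded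
perturbation changes the Poincaré constant at most by their ratio, which is the stated factor. At D
= D_{K,N} that factor is infinite, and λ[h_0] > 0 rules out 0 · ∞.

Lower bound: truncating f at t and reflecting it oddly about D/2 gives λ[h_0] ∫ h_0 (f - f(D/2))² ≤
∫ h_0 |f'|² over every interval (D/2, t). The superlevel sets of r on (D/2, D) are such intervals up
to an endpoint, so integrating over levels replaces h_0 by h_0 r = h_K
(`setLIntegral_mul_ofReal_le_of_antitoneOn`). The left half follows by reflection with the same
constant f(D/2), and a mean-zero f has no larger L² norm than f - f(D/2). -/

/-- A bounded measurable density `h ≥ 0` on `ℝ` that vanishes outside `[0, D]`. -/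
structure IsIntervalDensity (D : ℝ) (h : ℝ → ℝ) : Prop where
  measurable : Measurable h
  nonneg : ∀ x, 0 ≤ h x
  eq_zero : ∀ x, x ∉ Set.Icc 0 D → h x = 0
  bounded : ∃ C, ∀ x, h x ≤ C

/-! ### Metric slope and weighted integrals on the line -/

theorem localLipschitzConstant_of_differentiableAt {f : ℝ → ℝ} {x : ℝ}
    (hf : DifferentiableAt ℝ f x) : localLipschitzConstant f x = ‖deriv f x‖ₑ := by
  have h := (hasDerivAt_iff_tendsto_slope.1 hf.hasDerivAt).enorm
  refine Tendsto.limsup_eq (h.congr' ?_)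
  filter_upwards [self_mem_nhdsWithin] with y hy
  have hy' : y - x ≠ 0 := sub_ne_zero.2 hy
  rw [slope_def_field, edist_eq_enorm_sub, edist_eq_enorm_sub, div_eq_mul_inv, enorm_mul,
    enorm_inv hy', div_eq_mul_inv]

theorem LocallyLipschitz.exists_lipschitzOnWith_uIcc {f : ℝ → ℝ} (hf : LocallyLipschitz f)
    (a b : ℝ) : ∃ C, LipschitzOnWith C f (Set.uIcc a b) :=
  LocallyLipschitzOn.exists_lipschitzOnWith_of_compact isCompact_uIcc hf.locallyLipschitzOn

theorem LocallyLipschitz.ae_differentiableAt_real {f : ℝ → ℝ} (hf : LocallyLipschitz f) :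
    ∀ᵐ x, DifferentiableAt ℝ f x := by
  have h : ∀ n : ℕ, ∀ᵐ x, x ∈ Set.uIcc (-(n : ℝ)) n → DifferentiableAt ℝ f x := fun n => by
    obtain ⟨C, hC⟩ := hf.exists_lipschitzOnWith_uIcc (-(n : ℝ)) n
    exact hC.absolutelyContinuousOnInterval.ae_differentiableAt
  filter_upwards [ae_all_iff.2 h] with x hx
  obtain ⟨n, hn⟩ := exists_nat_ge |x|
  refine hx n ?_
  rw [Set.uIcc_of_le (by linarith [abs_nonneg x])]
  exact abs_le.1 hn

theorem LocallyLipschitz.localLipschitzConstant_ae_eq {f : ℝ → ℝ} (hf : LocallyLipschitz f) :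
    ∀ᵐ x, localLipschitzConstant f x = ‖deriv f x‖ₑ :=
  hf.ae_differentiableAt_real.mono fun _ hx => localLipschitzConstant_of_differentiableAt hx

theorem LocallyLipschitz.comp_const_sub {f : ℝ → ℝ} (hf : LocallyLipschitz f) (D : ℝ) :
    LocallyLipschitz fun x => f (D - x) :=
  hf.comp (LocallyLipschitz.sub (.const D) .id)

/-- The density is finite, so `g` need not be measurable; this spares a measurability proof for the
local Lipschitz constant. -/
theorem lintegral_withDensity_ofReal {h : ℝ → ℝ} (hh : Measurable h) (g : ℝ → ℝ≥0∞) :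
    ∫⁻ x, g x ∂(volume.withDensity fun x => ENNReal.ofReal (h x)) =
      ∫⁻ x, ENNReal.ofReal (h x) * g x :=
  lintegral_withDensity_eq_lintegral_mul_non_measurable _ hh.ennreal_ofReal (by simp) g

theorem integral_withDensity_ofReal {h : ℝ → ℝ} (hh : Measurable h) (h0 : ∀ x, 0 ≤ h x)
    (g : ℝ → ℝ) :
    ∫ x, g x ∂(volume.withDensity fun x => ENNReal.ofReal (h x)) = ∫ x, h x * g x := by
  rw [integral_withDensity_eq_integral_toReal_smul hh.ennreal_ofReal (by simp)]
  simp [ENNReal.toReal_ofReal (h0 _)]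

theorem lintegral_localLipschitzConstant {f h : ℝ → ℝ} (hf : LocallyLipschitz f)
    (hh : Measurable h) :
    ∫⁻ x, localLipschitzConstant f x ^ 2 ∂(volume.withDensity fun x => ENNReal.ofReal (h x)) =
      ∫⁻ x, ENNReal.ofReal (h x) * ‖deriv f x‖ₑ ^ 2 := by
  rw [lintegral_withDensity_ofReal hh]
  refine lintegral_congr_ae ?_
  filter_upwards [hf.localLipschitzConstant_ae_eq] with x hx
  rw [hx]

/-! ### Poincaré inequalities for interval densities -/

namespace IsIntervalDensity

variable {D : ℝ} {h f : ℝ → ℝ}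

theorem integrable_mul (hh : IsIntervalDensity D h) (hf : Continuous f) :
    Integrable fun x => h x * f x := by
  obtain ⟨C, hC⟩ := hh.bounded
  have hi : IntegrableOn (fun x => h x * f x) (Set.Icc 0 D) := by
    refine Integrable.bdd_mul (c := C) hf.continuousOn.integrableOn_Icc
      hh.measurable.aestronglyMeasurable (Eventually.of_forall fun x => ?_)
    rw [Real.norm_of_nonneg (hh.nonneg x)]
    exact hC x
  refine (integrableOn_iff_integrable_of_support_subset fun x hx => ?_).1 hi
  by_contra hx'
  exact hx (by simp [hh.eq_zero x hx'])

theorem lintegral_sq (hh : IsIntervalDensity D h) (hf : Continuous f) :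
    ∫⁻ x, ENNReal.ofReal (h x) * ENNReal.ofReal (f x ^ 2) =
      ENNReal.ofReal (∫ x, h x * f x ^ 2) := by
  have hi : Integrable fun x => h x * f x ^ 2 := hh.integrable_mul (hf.pow 2)
  rw [ofReal_integral_eq_lintegral_ofReal hi
    (Eventually.of_forall fun x => mul_nonneg (hh.nonneg x) (sq_nonneg _))]
  simp only [ENNReal.ofReal_mul (hh.nonneg _)]

/-- The product form also covers `f` vanishing almost everywhere for `h dx`, which is not a test
function: there the left side is zero even if the constant is infinite. -/
theorem densityPoincareConstant_mul_le (hh : IsIntervalDensity D h) (hf : LocallyLipschitz f)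
    (hmean : ∫ x, h x * f x = 0) :
    densityPoincareConstant h * ∫⁻ x, ENNReal.ofReal (h x) * ENNReal.ofReal (f x ^ 2) ≤
      ∫⁻ x, ENNReal.ofReal (h x) * ‖deriv f x‖ₑ ^ 2 := by
  rcases eq_or_ne (∫⁻ x, ENNReal.ofReal (h x) * ENNReal.ofReal (f x ^ 2)) 0 with h0 | h0
  · simp [h0]
  · refine ENNReal.mul_le_of_le_div ?_
    rw [← lintegral_localLipschitzConstant hf hh.measurable,
      ← lintegral_withDensity_ofReal hh.measurable]
    refine iInf₂_le f ⟨hf, ?_, ?_, ?_, ?_⟩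
    · rw [integrable_withDensity_iff hh.measurable.ennreal_ofReal (by simp)]
      simp only [ENNReal.toReal_ofReal (hh.nonneg _)]
      simpa only [mul_comm] using hh.integrable_mul hf.continuous
    · rw [integral_withDensity_ofReal hh.measurable hh.nonneg, hmean]
    · rw [lintegral_withDensity_ofReal hh.measurable]
      exact pos_iff_ne_zero.2 h0
    · rw [lintegral_withDensity_ofReal hh.measurable, hh.lintegral_sq hf.continuous]
      exact ENNReal.ofReal_lt_top

theorem le_densityPoincareConstant (hh : IsIntervalDensity D h) {c : ℝ≥0∞}
    (hc : ∀ f : ℝ → ℝ, LocallyLipschitz f → ∫ x, h x * f x = 0 →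
      c * ∫⁻ x, ENNReal.ofReal (h x) * ENNReal.ofReal (f x ^ 2) ≤
        ∫⁻ x, ENNReal.ofReal (h x) * ‖deriv f x‖ₑ ^ 2) :
    c ≤ densityPoincareConstant h := by
  refine le_iInf₂ fun f ⟨hf, _, hmean, hpos, hfin⟩ => ?_
  rw [ENNReal.le_div_iff_mul_le (.inl hpos.ne') (.inl hfin.ne),
    lintegral_localLipschitzConstant hf hh.measurable, lintegral_withDensity_ofReal hh.measurable]
  rw [integral_withDensity_ofReal hh.measurable hh.nonneg] at hmean
  exact hc f hf hmean

/-- The mean is the constant closest to `f` in L²; expanding the square leaves the surplus c² ∫ h ≥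
0. -/
theorem lintegral_sq_le_lintegral_sub_sq (hh : IsIntervalDensity D h) (hf : Continuous f)
    (hmean : ∫ x, h x * f x = 0) (c : ℝ) :
    ∫⁻ x, ENNReal.ofReal (h x) * ENNReal.ofReal (f x ^ 2) ≤
      ∫⁻ x, ENNReal.ofReal (h x) * ENNReal.ofReal ((f x - c) ^ 2) := by
  rw [hh.lintegral_sq hf, hh.lintegral_sq (f := fun x => f x - c) (by fun_prop)]
  refine ENNReal.ofReal_le_ofReal ?_
  have h1 : Integrable h := by simpa using hh.integrable_mul (continuous_const (y := (1 : ℝ)))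
  have e : ∀ x, h x * (f x - c) ^ 2 = h x * f x ^ 2 - 2 * c * (h x * f x) + c ^ 2 * h x :=
    fun x => by ring
  simp only [e]
  have i1 : Integrable fun x => h x * f x ^ 2 := hh.integrable_mul (hf.pow 2)
  have i2 := (hh.integrable_mul hf).const_mul (2 * c)
  rw [integral_add (f := fun x => h x * f x ^ 2 - 2 * c * (h x * f x)) (i1.sub i2)
    (h1.const_mul _), integral_sub i1 i2, integral_const_mul,
    integral_const_mul, hmean]
  have : 0 ≤ c ^ 2 * ∫ x, h x := mul_nonneg (sq_nonneg _) (integral_nonneg hh.nonneg)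
  linarith

end IsIntervalDensity

/-! ### Reflection, layer cake and a pointwise energy bound -/

theorem setLIntegral_Ioi_eq_Ioo {a t : ℝ} {φ : ℝ → ℝ≥0∞} (hφ : ∀ x, t < x → φ x = 0) :
    ∫⁻ x in Set.Ioi a, φ x = ∫⁻ x in Set.Ioo a t, φ x := by
  rw [← lintegral_indicator measurableSet_Ioi, ← lintegral_indicator measurableSet_Ioo]
  refine lintegral_congr_ae ?_
  filter_upwards [Measure.ae_ne volume t] with x hx
  rcases lt_or_gt_of_ne hx with h | h
  · simp [Set.indicator, h]
  · simp [Set.indicator, hφ x h]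

theorem lintegral_eq_add_reflect (D : ℝ) (φ : ℝ → ℝ≥0∞) :
    ∫⁻ x, φ x = (∫⁻ x in Set.Ioi (D / 2), φ (D - x)) + ∫⁻ x in Set.Ioi (D / 2), φ x := by
  have h : (∫⁻ x in Set.Ioi (D / 2), φ (D - x)) = ∫⁻ x in Set.Iio (D / 2), φ x := by
    rw [← (Measure.measurePreserving_sub_left volume D).setLIntegral_comp_preimage_emb
      (MeasurableEquiv.subLeft D).measurableEmbedding φ (Set.Iio (D / 2))]
    congr 2
    ext x
    simp only [Set.mem_Ioi, Set.mem_preimage, Set.mem_Iio]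
    constructor <;> intro <;> linarith
  rw [h, setLIntegral_congr (Iio_ae_eq_Iic (a := D / 2)), add_comm,
    ← lintegral_add_compl φ (measurableSet_Ioi (a := D / 2)), Set.compl_Ioi]

theorem lintegral_eq_two_mul_of_symm {D : ℝ} {φ : ℝ → ℝ≥0∞} (hφ : ∀ x, φ (D - x) = φ x) :
    ∫⁻ x, φ x = 2 * ∫⁻ x in Set.Ioi (D / 2), φ x := by
  rw [lintegral_eq_add_reflect D, two_mul]
  simp only [hφ]

/-- Layer cake in `r`: each superlevel set is an initial interval of (a, b), up to its right
endpoint, and on those the inequality is assumed. -/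
theorem setLIntegral_mul_ofReal_le_of_antitoneOn {a b : ℝ} {φ ψ : ℝ → ℝ≥0∞} {r : ℝ → ℝ}
    (hφ : Measurable φ) (hψ : Measurable ψ) (hr : AntitoneOn r (Set.Ioo a b))
    (hr0 : ∀ x ∈ Set.Ioo a b, 0 ≤ r x)
    (hle : ∀ t ∈ Set.Icc a b, ∫⁻ x in Set.Ioo a t, φ x ≤ ∫⁻ x in Set.Ioo a t, ψ x) :
    ∫⁻ x in Set.Ioo a b, φ x * ENNReal.ofReal (r x) ≤
      ∫⁻ x in Set.Ioo a b, ψ x * ENNReal.ofReal (r x) := by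
  have hrm : AEMeasurable r (volume.restrict (Set.Ioo a b)) :=
    aemeasurable_restrict_of_antitoneOn measurableSet_Ioo hr
  have key : ∀ {χ : ℝ → ℝ≥0∞}, Measurable χ →
      ∫⁻ x in Set.Ioo a b, χ x * ENNReal.ofReal (r x) =
        ∫⁻ s in Set.Ioi 0, ∫⁻ x in {x | s < r x} ∩ Set.Ioo a b, χ x := by
    intro χ hχ
    have h1 := lintegral_withDensity_eq_lintegral_mul₀ hχ.aemeasurable hrm.ennreal_ofReal
    simp only [Pi.mul_apply] at h1
    have hac := withDensity_absolutelyContinuous (volume.restrict (Set.Ioo a b)) χ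
    rw [← h1, lintegral_eq_lintegral_meas_lt _
      (hac.ae_le ((ae_restrict_iff' measurableSet_Ioo).2 (Eventually.of_forall hr0)))
      (hrm.mono_ac hac)]
    refine lintegral_congr fun s => ?_
    rw [withDensity_apply', Measure.restrict_restrict' measurableSet_Ioo]
  rw [key hφ, key hψ]
  refine lintegral_mono fun s => ?_
  rcases Set.eq_empty_or_nonempty ({x | s < r x} ∩ Set.Ioo a b) with he | hne
  · simp [he]
  · set S := {x | s < r x} ∩ Set.Ioo a b with hS
    have hbdd : BddAbove S := ⟨b, fun x hx => hx.2.2.le⟩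
    have hsub : S ⊆ Set.Ioc a (sSup S) := fun x hx => ⟨hx.2.1, le_csSup hbdd hx⟩
    have hsup : Set.Ioo a (sSup S) ⊆ S := by
      intro x hx
      obtain ⟨y, hy, hxy⟩ := exists_lt_of_lt_csSup hne hx.2
      have hxI : x ∈ Set.Ioo a b := ⟨hx.1, hxy.trans hy.2.2⟩
      exact ⟨lt_of_lt_of_le hy.1 (hr hxI hy.2 hxy.le), hxI⟩
    have ht : sSup S ∈ Set.Icc a b := by
      obtain ⟨y, hy⟩ := hne
      exact ⟨hy.2.1.le.trans (le_csSup hbdd hy), csSup_le ⟨y, hy⟩ fun x hx => hx.2.2.le⟩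
    calc ∫⁻ x in S, φ x ≤ ∫⁻ x in Set.Ioc a (sSup S), φ x := lintegral_mono_set hsub
      _ = ∫⁻ x in Set.Ioo a (sSup S), φ x := setLIntegral_congr Ioo_ae_eq_Ioc.symm
      _ ≤ ∫⁻ x in Set.Ioo a (sSup S), ψ x := hle _ ht
      _ ≤ ∫⁻ x in S, ψ x := lintegral_mono_set hsup

/-- Fundamental theorem of calculus followed by Cauchy–Schwarz. -/
theorem LocallyLipschitz.ofReal_sub_sq_le {f : ℝ → ℝ} (hf : LocallyLipschitz f) {D x : ℝ}
    (hx : x ∈ Set.Icc 0 D) :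
    ENNReal.ofReal ((f x - f 0) ^ 2) ≤
      ENNReal.ofReal D * ∫⁻ y in Set.Icc 0 D, ‖deriv f y‖ₑ ^ 2 := by
  obtain ⟨C, hC⟩ := hf.exists_lipschitzOnWith_uIcc 0 x
  have h1 : ‖f x - f 0‖ₑ ≤ ∫⁻ y in Set.Icc 0 D, ‖deriv f y‖ₑ := by
    rw [← hC.absolutelyContinuousOnInterval.integral_deriv_eq_sub,
      intervalIntegral.integral_of_le hx.1]
    exact (enorm_integral_le_lintegral_enorm _).trans
      (lintegral_mono_set fun y hy => ⟨hy.1.le, hy.2.trans hx.2⟩)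
  have h2 := ENNReal.lintegral_mul_le_Lp_mul_Lq (volume.restrict (Set.Icc 0 D))
    Real.HolderConjugate.two_two (f := 1) (g := fun y => ‖deriv f y‖ₑ) aemeasurable_const
    (measurable_deriv f).enorm.aemeasurable
  simp only [Pi.mul_apply, Pi.one_apply, one_mul, one_pow, lintegral_const,
    Measure.restrict_apply MeasurableSet.univ, Set.univ_inter, Real.volume_Icc, sub_zero,
    ENNReal.rpow_two] at h2
  have sq : ∀ z : ℝ≥0∞, (z ^ (1 / 2 : ℝ)) ^ 2 = z := fun z => by
    rw [← ENNReal.rpow_natCast, ← ENNReal.rpow_mul]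
    norm_num
  calc ENNReal.ofReal ((f x - f 0) ^ 2) = ‖f x - f 0‖ₑ ^ 2 := by
        rw [← enorm_pow, Real.enorm_of_nonneg (sq_nonneg _)]
    _ ≤ (ENNReal.ofReal D ^ (1 / 2 : ℝ) *
          (∫⁻ y in Set.Icc 0 D, ‖deriv f y‖ₑ ^ 2) ^ (1 / 2 : ℝ)) ^ 2 := by
        gcongr
        exact h1.trans h2
    _ = _ := by rw [mul_pow, sq, sq]

/-! ### Comparison of Poincaré constants -/

namespace IsIntervalDensity

variable {D : ℝ} {h h₀ h₁ f r : ℝ → ℝ}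

/-- Reflecting the truncation of `f` to `[D / 2, t]` oddly about `D / 2` gives a test function. -/
theorem densityPoincareConstant_mul_setLIntegral_Ioo_le (hh : IsIntervalDensity D h)
    (hsymm : ∀ x, h (D - x) = h x) (hf : LocallyLipschitz f) {t : ℝ} (ht : D / 2 ≤ t) :
    densityPoincareConstant h * ∫⁻ x in Set.Ioo (D / 2) t,
        ENNReal.ofReal (h x) * ENNReal.ofReal ((f x - f (D / 2)) ^ 2) ≤
      ∫⁻ x in Set.Ioo (D / 2) t, ENNReal.ofReal (h x) * ‖deriv f x‖ₑ ^ 2 := by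
  -- `G` freezes `f` at its values at D/2 and t outside [D/2, t], so its odd part `F` is constant
  -- beyond t and has no energy there.
  set G : ℝ → ℝ := fun x => f (max (D / 2) (min x t)) with hG
  set F : ℝ → ℝ := fun x => G x - G (D - x) with hF
  have hGL : LocallyLipschitz G := hf.comp ((LocallyLipschitz.id.min_const t).const_max (D / 2))
  have hFL : LocallyLipschitz F := hGL.sub (hGL.comp_const_sub D)
  have hodd : ∀ x, F (D - x) = -F x := fun x => by simp [hF]
  have hderiv : ∀ x, deriv F (D - x) = deriv F x := fun x => by
    have h1 : deriv (fun y => F (D - y)) x = -deriv F (D - x) := deriv_comp_const_sub ..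
    simp only [hodd] at h1
    rw [deriv.fun_neg] at h1
    linarith
  have hleft : ∀ x, D / 2 < x → G (D - x) = f (D / 2) := fun x hx => by
    simp only [hG]
    rw [max_eq_left ((min_le_left _ _).trans (by linarith))]
  have hF1 : ∀ x ∈ Set.Ioo (D / 2) t, F x = f x - f (D / 2) := fun x hx => by
    simp only [hF]
    rw [hleft x hx.1]
    simp only [hG]
    rw [min_eq_left hx.2.le, max_eq_right hx.1.le]
  have hF2 : ∀ x, t < x → F x = f t - f (D / 2) := fun x hx => by
    simp only [hF]
    rw [hleft x (ht.trans_lt hx)]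
    simp only [hG]
    rw [min_eq_right hx.le, max_eq_right ht]
  have hd1 : ∀ x ∈ Set.Ioo (D / 2) t, deriv F x = deriv f x := fun x hx => by
    have : F =ᶠ[𝓝 x] fun y => f y - f (D / 2) :=
      eventually_of_mem (isOpen_Ioo.mem_nhds hx) hF1
    rw [this.deriv_eq, deriv_sub_const]
  have hd2 : ∀ x, t < x → deriv F x = 0 := fun x hx => by
    have : F =ᶠ[𝓝 x] fun _ => f t - f (D / 2) := by
      filter_upwards [isOpen_Ioi.mem_nhds hx] with y hy using hF2 y hy
    rw [this.deriv_eq, deriv_const]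
  have hmean : ∫ x, h x * F x = 0 := by
    have h1 := integral_sub_left_eq_self (fun x => h x * F x) volume D
    simp only [hsymm, hodd, mul_neg, integral_neg] at h1
    linarith
  have main := hh.densityPoincareConstant_mul_le hFL hmean
  rw [lintegral_eq_two_mul_of_symm (D := D) (fun x => by rw [hsymm, hodd, neg_sq]),
    lintegral_eq_two_mul_of_symm (D := D) (fun x => by rw [hsymm, hderiv]), mul_left_comm,
    ENNReal.mul_le_mul_iff_right (by simp) (by simp),
    setLIntegral_Ioi_eq_Ioo (t := t) (φ := fun x => ENNReal.ofReal (h x) * ‖deriv F x‖ₑ ^ 2)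
      (fun x hx => by simp [hd2 x hx])] at main
  -- Beyond t only the L² term survives, and it is on the side that may be decreased.
  calc _ ≤ densityPoincareConstant h * ∫⁻ x in Set.Ioi (D / 2),
        ENNReal.ofReal (h x) * ENNReal.ofReal (F x ^ 2) := by
        refine mul_le_mul_right ?_ _
        refine Eq.trans_le ?_ (lintegral_mono_set (s := Set.Ioo (D / 2) t) Set.Ioo_subset_Ioi_self)
        exact setLIntegral_congr_fun measurableSet_Ioo fun x hx => by rw [hF1 x hx]
    _ ≤ _ := main
    _ = _ := setLIntegral_congr_fun measurableSet_Ioo fun x hx => by rw [hd1 x hx]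

/-- Multiplying a symmetric density by a symmetric factor that decreases away from the centre
does not decrease the Poincaré constant. -/
theorem densityPoincareConstant_le_of_antitoneOn (hh₀ : IsIntervalDensity D h₀)
    (hh₁ : IsIntervalDensity D h₁) (hs₀ : ∀ x, h₀ (D - x) = h₀ x) (hs₁ : ∀ x, h₁ (D - x) = h₁ x)
    (hr : AntitoneOn r (Set.Ioo (D / 2) D)) (hr0 : ∀ x ∈ Set.Ioo (D / 2) D, 0 ≤ r x)
    (hmul : ∀ x ∈ Set.Ioo (D / 2) D, h₁ x = h₀ x * r x) :
    densityPoincareConstant h₀ ≤ densityPoincareConstant h₁ := by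
  have half : ∀ f : ℝ → ℝ, LocallyLipschitz f →
      densityPoincareConstant h₀ * ∫⁻ x in Set.Ioi (D / 2),
          ENNReal.ofReal (h₁ x) * ENNReal.ofReal ((f x - f (D / 2)) ^ 2) ≤
        ∫⁻ x in Set.Ioi (D / 2), ENNReal.ofReal (h₁ x) * ‖deriv f x‖ₑ ^ 2 := by
    intro f hf
    have hz : ∀ x, D < x → ENNReal.ofReal (h₁ x) = 0 := fun x hx => by
      rw [hh₁.eq_zero x fun h => h.2.not_gt hx, ENNReal.ofReal_zero]
    have hfm := hf.continuous.measurable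
    have hm₀ := hh₀.measurable
    have hm : Measurable fun x => ENNReal.ofReal (h₀ x) *
        ENNReal.ofReal ((f x - f (D / 2)) ^ 2) := by fun_prop
    rw [setLIntegral_Ioi_eq_Ioo (t := D) fun x hx => by rw [hz x hx, zero_mul],
      setLIntegral_Ioi_eq_Ioo (t := D) fun x hx => by rw [hz x hx, zero_mul]]
    have key := setLIntegral_mul_ofReal_le_of_antitoneOn
      (φ := fun x => densityPoincareConstant h₀ *
        (ENNReal.ofReal (h₀ x) * ENNReal.ofReal ((f x - f (D / 2)) ^ 2)))
      (ψ := fun x => ENNReal.ofReal (h₀ x) * ‖deriv f x‖ₑ ^ 2) (hm.const_mul _)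
      (hm₀.ennreal_ofReal.mul ((measurable_deriv f).enorm.pow_const 2)) hr hr0 (fun t ht => by
        rw [lintegral_const_mul _ hm]
        exact hh₀.densityPoincareConstant_mul_setLIntegral_Ioo_le hs₀ hf ht.1)
    have hm₁ := hh₁.measurable
    rw [← lintegral_const_mul _ (by fun_prop)]
    convert key using 1
    · refine setLIntegral_congr_fun measurableSet_Ioo fun x hx => ?_
      rw [hmul x hx, ENNReal.ofReal_mul (hh₀.nonneg x)]
      ring
    · refine setLIntegral_congr_fun measurableSet_Ioo fun x hx => ?_
      rw [hmul x hx, ENNReal.ofReal_mul (hh₀.nonneg x)]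
      ring
  refine hh₁.le_densityPoincareConstant fun f hf hmean => ?_
  calc _ ≤ densityPoincareConstant h₀ * ∫⁻ x, ENNReal.ofReal (h₁ x) *
        ENNReal.ofReal ((f x - f (D / 2)) ^ 2) := by
        exact mul_le_mul_right (hh₁.lintegral_sq_le_lintegral_sub_sq hf.continuous hmean _) _
    _ ≤ _ := by
      rw [lintegral_eq_add_reflect D, lintegral_eq_add_reflect D, mul_add]
      refine add_le_add ?_ (half f hf)
      -- The reflected function has the same value at D/2, so both halves subtract the same
      -- constant.
      have := half _ (hf.comp_const_sub D)
      simp only [deriv_comp_const_sub, enorm_neg, sub_half] at this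
      simpa only [hs₁] using this

/-- Comparison of Poincaré constants when `c * h₀ ≤ h₁ ≤ C * h₀`. -/
theorem densityPoincareConstant_le_mul_div (hh₀ : IsIntervalDensity D h₀)
    (hh₁ : IsIntervalDensity D h₁) {c C : ℝ} (hc : 0 < c) (hC : 0 < C) (hpos : 0 < ∫ x, h₁ x)
    (hle : ∀ x, c * h₀ x ≤ h₁ x) (hge : ∀ x, h₁ x ≤ C * h₀ x) :
    densityPoincareConstant h₁ ≤
      densityPoincareConstant h₀ * (ENNReal.ofReal C / ENNReal.ofReal c) := by
  have hc0 : ENNReal.ofReal c ≠ 0 := by simpa using hc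
  have hC0 : ENNReal.ofReal C ≠ 0 := by simpa using hC
  have main : densityPoincareConstant h₁ * ENNReal.ofReal c / ENNReal.ofReal C ≤
      densityPoincareConstant h₀ := by
    refine hh₀.le_densityPoincareConstant fun f hf hmean => ?_
    -- Recentring by the `h₁`-mean makes `f - m` admissible for `h₁` without changing the
    -- derivative.
    set m := (∫ x, h₁ x * f x) / ∫ x, h₁ x with hm
    have hi : Integrable h₁ := by
      simpa using hh₁.integrable_mul (continuous_const (y := (1 : ℝ)))
    have hmean₁ : ∫ x, h₁ x * (f x - m) = 0 := by
      simp only [mul_sub]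
      rw [integral_sub (hh₁.integrable_mul hf.continuous) (hi.mul_const m), integral_mul_const, hm,
        mul_div_cancel₀ _ hpos.ne', sub_self]
    have h1 := hh₁.densityPoincareConstant_mul_le (hf.sub (.const m)) hmean₁
    simp only [deriv_sub_const] at h1
    have h2 : ENNReal.ofReal c * ∫⁻ x, ENNReal.ofReal (h₀ x) * ENNReal.ofReal (f x ^ 2) ≤
        ∫⁻ x, ENNReal.ofReal (h₁ x) * ENNReal.ofReal ((f x - m) ^ 2) := by
      grw [hh₀.lintegral_sq_le_lintegral_sub_sq hf.continuous hmean m]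
      rw [← lintegral_const_mul' _ _ ENNReal.ofReal_ne_top]
      refine lintegral_mono fun x => ?_
      rw [← mul_assoc, ← ENNReal.ofReal_mul hc.le]
      gcongr
      exact hle x
    have h3 : ∫⁻ x, ENNReal.ofReal (h₁ x) * ‖deriv f x‖ₑ ^ 2 ≤
        ENNReal.ofReal C * ∫⁻ x, ENNReal.ofReal (h₀ x) * ‖deriv f x‖ₑ ^ 2 := by
      rw [← lintegral_const_mul' _ _ ENNReal.ofReal_ne_top]
      refine lintegral_mono fun x => ?_
      rw [← mul_assoc, ← ENNReal.ofReal_mul hC.le]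
      gcongr
      exact hge x
    rw [div_eq_mul_inv, mul_right_comm, ← div_eq_mul_inv]
    refine ENNReal.div_le_of_le_mul' ?_
    rw [mul_assoc]
    exact (mul_le_mul_right h2 _).trans (h1.trans h3)
  rw [← mul_div_assoc, ENNReal.le_div_iff_mul_le (.inl hc0) (.inl ENNReal.ofReal_ne_top)]
  rwa [ENNReal.div_le_iff hC0 ENNReal.ofReal_ne_top] at main

/-- A density bounded below by a positive constant on `[0, D]` has a positive Poincaré constant. -/
theorem densityPoincareConstant_ne_zero (hh : IsIntervalDensity D h) {c : ℝ} (hc : 0 < c)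
    (hle : ∀ x ∈ Set.Icc 0 D, c ≤ h x) : densityPoincareConstant h ≠ 0 := by
  obtain ⟨C, hC⟩ := hh.bounded
  have hc0 : ENNReal.ofReal c ≠ 0 := by simpa using hc
  have hfin : ENNReal.ofReal C * ENNReal.ofReal D * ENNReal.ofReal D ≠ ∞ :=
    ENNReal.mul_ne_top (ENNReal.mul_ne_top ENNReal.ofReal_ne_top ENNReal.ofReal_ne_top)
      ENNReal.ofReal_ne_top
  -- One factor `D` comes from Cauchy–Schwarz, the other from integrating the pointwise bound over
  -- `[0, D]`.
  have main : ENNReal.ofReal c / (ENNReal.ofReal C * ENNReal.ofReal D * ENNReal.ofReal D) ≤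
      densityPoincareConstant h := by
    refine hh.le_densityPoincareConstant fun f hf hmean => ?_
    have h1 : ENNReal.ofReal c * ∫⁻ x in Set.Icc 0 D, ‖deriv f x‖ₑ ^ 2 ≤
        ∫⁻ x, ENNReal.ofReal (h x) * ‖deriv f x‖ₑ ^ 2 := by
      rw [← lintegral_const_mul' _ _ ENNReal.ofReal_ne_top]
      refine (setLIntegral_mono' measurableSet_Icc fun x hx => ?_).trans
        (setLIntegral_le_lintegral (Set.Icc 0 D) _)
      gcongr
      exact hle x hx
    have h2 : ∫⁻ x, ENNReal.ofReal (h x) * ENNReal.ofReal ((f x - f 0) ^ 2) ≤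
        ENNReal.ofReal C * ENNReal.ofReal D * ENNReal.ofReal D *
          ∫⁻ x in Set.Icc 0 D, ‖deriv f x‖ₑ ^ 2 := by
      calc _ = ∫⁻ x in Set.Icc 0 D, ENNReal.ofReal (h x) * ENNReal.ofReal ((f x - f 0) ^ 2) := by
            refine (setLIntegral_eq_of_support_subset fun x hx => ?_).symm
            by_contra hx'
            exact hx (by simp [hh.eq_zero x hx'])
        _ ≤ ∫⁻ x in Set.Icc 0 D, ENNReal.ofReal C *
            (ENNReal.ofReal D * ∫⁻ x in Set.Icc 0 D, ‖deriv f x‖ₑ ^ 2) := by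
            refine setLIntegral_mono' measurableSet_Icc fun x hx => ?_
            gcongr
            · exact hC x
            · exact hf.ofReal_sub_sq_le hx
        _ = _ := by
            rw [setLIntegral_const, Real.volume_Icc, sub_zero]
            ring
    calc _ ≤ ENNReal.ofReal c / (ENNReal.ofReal C * ENNReal.ofReal D * ENNReal.ofReal D) *
          (ENNReal.ofReal C * ENNReal.ofReal D * ENNReal.ofReal D *
            ∫⁻ x in Set.Icc 0 D, ‖deriv f x‖ₑ ^ 2) :=
          mul_le_mul_right
            ((hh.lintegral_sq_le_lintegral_sub_sq hf.continuous hmean (f 0)).trans h2) _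
      _ ≤ ENNReal.ofReal c * ∫⁻ x in Set.Icc 0 D, ‖deriv f x‖ₑ ^ 2 := by
          rw [← mul_assoc, mul_comm (_ / _)]
          exact mul_le_mul_left ENNReal.mul_div_le _
      _ ≤ _ := h1
  exact ((ENNReal.div_pos hc0 hfin).trans_le main).ne'

end IsIntervalDensity

/-! ### The functions s_κ and the monotonicity of sin x / x -/

theorem sKappa_zero (θ : ℝ) : sKappa 0 θ = θ := by simp [sKappa]

theorem sKappa_of_pos {κ : ℝ} (hκ : 0 < κ) (θ : ℝ) :
    sKappa κ θ = 1 / √κ * Real.sin (√κ * θ) := by simp [sKappa, hκ]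

theorem sKappa_nonneg {κ θ : ℝ} (hκ : 0 < κ) (hθ : 0 ≤ θ) (hπ : √κ * θ ≤ Real.pi) :
    0 ≤ sKappa κ θ := by
  rw [sKappa_of_pos hκ]
  exact mul_nonneg (by positivity) (Real.sin_nonneg_of_nonneg_of_le_pi (by positivity) hπ)

theorem sKappa_pos {κ θ : ℝ} (hκ : 0 < κ) (hθ : 0 < θ) (hπ : √κ * θ < Real.pi) :
    0 < sKappa κ θ := by
  rw [sKappa_of_pos hκ]
  have := Real.sqrt_pos.2 hκ
  exact mul_pos (by positivity) (Real.sin_pos_of_pos_of_lt_pi (by positivity) hπ)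

theorem sKappa_le_self {κ θ : ℝ} (hκ : 0 < κ) (hθ : 0 ≤ θ) : sKappa κ θ ≤ θ := by
  have hs := Real.sqrt_pos.2 hκ
  rw [sKappa_of_pos hκ, one_div, inv_mul_le_iff₀ hs]
  exact Real.sin_le (by positivity)

theorem continuous_sKappa_of_pos {κ : ℝ} (hκ : 0 < κ) : Continuous (sKappa κ) := by
  have : sKappa κ = fun θ => 1 / √κ * Real.sin (√κ * θ) := funext (sKappa_of_pos hκ)
  rw [this]
  fun_prop

theorem sin_div_self_antitoneOn :
    AntitoneOn (fun x => Real.sin x / x) (Set.Ioc 0 Real.pi) := by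
  intro x hx y hy hxy
  -- Concavity at x = (1 - x/y) · 0 + (x/y) · y.
  have h := strictConcaveOn_sin_Icc.concaveOn.2 (Set.left_mem_Icc.2 Real.pi_pos.le)
    ⟨hy.1.le, hy.2⟩
    (sub_nonneg.2 (div_le_one_of_le₀ hxy hy.1.le)) (div_nonneg hx.1.le hy.1.le)
    (sub_add_cancel _ _)
  simp only [smul_eq_mul, Real.sin_zero, mul_zero, zero_add, div_mul_cancel₀ x hy.1.ne'] at h
  simp only
  rw [div_le_div_iff₀ hy.1 hx.1]
  rw [div_mul_eq_mul_div, div_le_iff₀ hy.1] at h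
  linarith

theorem sKappa_div_self_antitoneOn {κ D : ℝ} (hκ : 0 < κ) (hD : √κ * D ≤ Real.pi) :
    AntitoneOn (fun x => sKappa κ x / x) (Set.Ioc 0 D) := by
  have hs := Real.sqrt_pos.2 hκ
  have e : ∀ x, sKappa κ x / x = Real.sin (√κ * x) / (√κ * x) := fun x => by
    rw [sKappa_of_pos hκ, div_mul_eq_mul_div, one_mul, div_div]
  intro x hx y hy hxy
  simp only [e]
  have hm : ∀ z ∈ Set.Ioc 0 D, √κ * z ∈ Set.Ioc 0 Real.pi := fun z hz =>
    ⟨mul_pos hs hz.1, (mul_le_mul_of_nonneg_left hz.2 hs.le).trans hD⟩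
  exact sin_div_self_antitoneOn (hm x hx) (hm y hy) (mul_le_mul_of_nonneg_left hxy hs.le)

/-! ### The model densities and their factorization -/

theorem modelDensity_of_mem {K N D x : ℝ} (hx : x ∈ Set.Icc 0 D) :
    modelDensity K N D x = sKappa (K / (N - 1)) (max x (D - x)) ^ (N - 1) := by
  rcases le_or_gt x (D / 2) with h | h
  · rw [modelDensity, if_pos ⟨hx.1, h⟩, max_eq_right (by linarith)]
  · rw [modelDensity, if_neg fun h' => h'.2.not_gt h, if_pos ⟨h.le, hx.2⟩,
      max_eq_left (by linarith)]

theorem modelDensity_of_notMem {K N D x : ℝ} (hD : 0 ≤ D) (hx : x ∉ Set.Icc 0 D) :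
    modelDensity K N D x = 0 := by
  rw [modelDensity, if_neg fun h => hx ⟨h.1, h.2.trans (by linarith)⟩,
    if_neg fun h => hx ⟨(by linarith : 0 ≤ D / 2).trans h.1, h.2⟩]

theorem modelDensity_symm {K N D : ℝ} (hD : 0 ≤ D) (x : ℝ) :
    modelDensity K N D (D - x) = modelDensity K N D x := by
  by_cases hx : x ∈ Set.Icc 0 D
  · rw [modelDensity_of_mem hx,
      modelDensity_of_mem ⟨sub_nonneg.2 hx.2, sub_le_self D hx.1⟩, sub_sub_cancel, max_comm]
  · rw [modelDensity_of_notMem hD hx, modelDensity_of_notMem hD fun h => hx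
      ⟨by linarith [h.2], by linarith [h.1]⟩]

theorem max_sub_mem_Icc {D x : ℝ} (hx : x ∈ Set.Icc 0 D) : max x (D - x) ∈ Set.Icc (D / 2) D := by
  refine ⟨?_, max_le hx.2 (sub_le_self D hx.1)⟩
  rcases le_total x (D / 2) with h | h
  · exact le_max_of_le_right (by linarith)
  · exact le_max_of_le_left h

theorem isIntervalDensity_modelDensity {K N D : ℝ} (hN : 1 < N) (hD : 0 < D)
    (hc : Continuous (sKappa (K / (N - 1))))
    (h0 : ∀ y ∈ Set.Icc (D / 2) D, 0 ≤ sKappa (K / (N - 1)) y)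
    (hle : ∀ y ∈ Set.Icc (D / 2) D, sKappa (K / (N - 1)) y ≤ y) :
    IsIntervalDensity D (modelDensity K N D) where
  measurable := by
    have hm := hc.measurable
    refine Measurable.ite measurableSet_Icc (by fun_prop) (Measurable.ite measurableSet_Icc
      (by fun_prop) measurable_const)
  nonneg x := by
    by_cases hx : x ∈ Set.Icc 0 D
    · rw [modelDensity_of_mem hx]
      exact Real.rpow_nonneg (h0 _ (max_sub_mem_Icc hx)) _
    · rw [modelDensity_of_notMem hD.le hx]
  eq_zero x hx := modelDensity_of_notMem hD.le hx
  bounded := by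
    refine ⟨D ^ (N - 1), fun x => ?_⟩
    by_cases hx : x ∈ Set.Icc 0 D
    · have hm := max_sub_mem_Icc hx
      rw [modelDensity_of_mem hx]
      exact Real.rpow_le_rpow (h0 _ hm) ((hle _ hm).trans hm.2) (by linarith)
    · rw [modelDensity_of_notMem hD.le hx]
      positivity

theorem isIntervalDensity_modelDensity_zero {N D : ℝ} (hN : 1 < N) (hD : 0 < D) :
    IsIntervalDensity D (modelDensity 0 N D) := by
  have e : sKappa (0 / (N - 1)) = fun x => x := by
    rw [zero_div]
    exact funext sKappa_zero
  refine isIntervalDensity_modelDensity hN hD ?_ ?_ ?_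
  · rw [e]
    exact continuous_id
  · rw [e]
    exact fun y hy => (by linarith : 0 ≤ D / 2).trans hy.1
  · rw [e]
    exact fun y _ => le_rfl

theorem isIntervalDensity_modelDensity_of_pos {K N D : ℝ} (hK : 0 < K) (hN : 1 < N) (hD : 0 < D)
    (hπ : √(K / (N - 1)) * D ≤ Real.pi) : IsIntervalDensity D (modelDensity K N D) := by
  have hκ : 0 < K / (N - 1) := div_pos hK (by linarith)
  have h0 : ∀ y ∈ Set.Icc (D / 2) D, 0 ≤ y := fun y hy => by linarith [hy.1]
  refine isIntervalDensity_modelDensity hN hD (continuous_sKappa_of_pos hκ) (fun y hy => ?_)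
    fun y hy => sKappa_le_self hκ (h0 y hy)
  refine sKappa_nonneg hκ (h0 y hy) (le_trans ?_ hπ)
  gcongr
  exact hy.2

theorem modelDensity_eq_mul {K N D x : ℝ} (hK : 0 < K) (hN : 1 < N) (hD : 0 < D)
    (hπ : √(K / (N - 1)) * D ≤ Real.pi) (hx : x ∈ Set.Icc 0 D) :
    modelDensity K N D x = modelDensity 0 N D x *
      (sKappa (K / (N - 1)) (max x (D - x)) / max x (D - x)) ^ (N - 1) := by
  have hκ : 0 < K / (N - 1) := div_pos hK (by linarith)
  have hm := max_sub_mem_Icc hx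
  have hm0 : 0 < max x (D - x) := (half_pos hD).trans_le hm.1
  have hs : 0 ≤ sKappa (K / (N - 1)) (max x (D - x)) := by
    refine sKappa_nonneg hκ hm0.le (le_trans ?_ hπ)
    gcongr
    exact hm.2
  rw [modelDensity_of_mem hx, modelDensity_of_mem hx, zero_div, sKappa_zero,
    ← Real.mul_rpow hm0.le (div_nonneg hs hm0.le), mul_div_cancel₀ _ hm0.ne']

/-! ### The two bounds for the model densities -/

theorem densityPoincareConstant_modelDensity_zero_le {K N D : ℝ} (hK : 0 < K) (hN : 1 < N)
    (hD : 0 < D) (hπ : √(K / (N - 1)) * D ≤ Real.pi) :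
    densityPoincareConstant (modelDensity 0 N D) ≤
      densityPoincareConstant (modelDensity K N D) := by
  have hκ : 0 < K / (N - 1) := div_pos hK (by linarith)
  have hsub : Set.Ioo (D / 2) D ⊆ Set.Ioc 0 D := fun x hx => ⟨(half_pos hD).trans hx.1, hx.2.le⟩
  have hquot : ∀ x ∈ Set.Ioo (D / 2) D, 0 ≤ sKappa (K / (N - 1)) x / x := fun x hx => by
    have hx' := hsub hx
    refine div_nonneg (sKappa_nonneg hκ hx'.1.le (le_trans ?_ hπ)) hx'.1.le
    gcongr
    exact hx'.2
  refine IsIntervalDensity.densityPoincareConstant_le_of_antitoneOn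
    (r := fun x => (sKappa (K / (N - 1)) x / x) ^ (N - 1))
    (isIntervalDensity_modelDensity_zero hN hD)
    (isIntervalDensity_modelDensity_of_pos hK hN hD hπ) (modelDensity_symm hD.le)
    (modelDensity_symm hD.le) ?_ ?_ ?_
  · intro x hx y hy hxy
    exact Real.rpow_le_rpow (hquot y hy)
      (sKappa_div_self_antitoneOn hκ hπ (hsub hx) (hsub hy) hxy) (by linarith)
  · exact fun x hx => Real.rpow_nonneg (hquot x hx) _
  · intro x hx
    rw [modelDensity_eq_mul hK hN hD hπ (Set.Ioc_subset_Icc_self (hsub hx)),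
      max_eq_left (by linarith [hx.1])]

theorem densityPoincareConstant_modelDensity_zero_ne_zero {N D : ℝ} (hN : 1 < N) (hD : 0 < D) :
    densityPoincareConstant (modelDensity 0 N D) ≠ 0 := by
  refine (isIntervalDensity_modelDensity_zero hN hD).densityPoincareConstant_ne_zero
    (c := (D / 2) ^ (N - 1)) (by positivity) fun x hx => ?_
  rw [modelDensity_of_mem hx, zero_div, sKappa_zero]
  exact Real.rpow_le_rpow (half_pos hD).le (max_sub_mem_Icc hx).1 (by linarith)

theorem densityPoincareConstant_modelDensity_le {K N D : ℝ} (hK : 0 < K) (hN : 1 < N)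
    (hD : 0 < D) (hπ : √(K / (N - 1)) * D < Real.pi) :
    densityPoincareConstant (modelDensity K N D) ≤
      densityPoincareConstant (modelDensity 0 N D) *
        (ENNReal.ofReal (2 * Real.sin (√(K / (N - 1)) * (D / 2))) /
          ENNReal.ofReal (Real.sin (√(K / (N - 1)) * D))) ^ (N - 1) := by
  have hκ : 0 < K / (N - 1) := div_pos hK (by linarith)
  set κ := K / (N - 1)
  have hs := Real.sqrt_pos.2 hκ
  have hD2 := half_pos hD
  have hpD : 0 < sKappa κ D := sKappa_pos hκ hD hπ
  have hpD2 : 0 < sKappa κ (D / 2) :=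
    sKappa_pos hκ hD2 ((mul_lt_mul_of_pos_left (half_lt_self hD) hs).trans hπ)
  have hsin : 0 < Real.sin (√κ * D) := Real.sin_pos_of_pos_of_lt_pi (by positivity) hπ
  have h₀ := isIntervalDensity_modelDensity_zero hN hD
  have h₁ := isIntervalDensity_modelDensity_of_pos hK hN hD hπ.le
  have hbd : ∀ x ∈ Set.Icc 0 D,
      sKappa κ D / D ≤ sKappa κ (max x (D - x)) / max x (D - x) ∧
        sKappa κ (max x (D - x)) / max x (D - x) ≤ sKappa κ (D / 2) / (D / 2) := fun x hx => by
    have hm := max_sub_mem_Icc hx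
    have hanti := sKappa_div_self_antitoneOn hκ hπ.le
    have hm' : max x (D - x) ∈ Set.Ioc 0 D := ⟨hD2.trans_le hm.1, hm.2⟩
    exact ⟨hanti hm' (Set.right_mem_Ioc.2 hD) hm.2, hanti ⟨hD2, by linarith⟩ hm' hm.1⟩
  have hpos : 0 < ∫ x, modelDensity K N D x := by
    rw [integral_pos_iff_support_of_nonneg h₁.nonneg
      (by simpa using h₁.integrable_mul (continuous_const (y := (1 : ℝ))))]
    refine lt_of_lt_of_le ?_ (measure_mono (s := Set.Icc 0 D) fun x hx => ?_)
    · simpa using hD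
    · have hm := max_sub_mem_Icc hx
      rw [Function.mem_support, modelDensity_of_mem hx]
      refine (Real.rpow_pos_of_pos (sKappa_pos hκ (hD2.trans_le hm.1) ?_) _).ne'
      exact (mul_le_mul_of_nonneg_left hm.2 hs.le).trans_lt hπ
  -- These are the extreme values of r, at the endpoints and at the centre; `c` is positive because
  -- D is strictly below the diameter bound.
  have key := h₀.densityPoincareConstant_le_mul_div h₁
    (c := (sKappa κ D / D) ^ (N - 1)) (C := (sKappa κ (D / 2) / (D / 2)) ^ (N - 1))
    (by positivity) (by positivity) hpos (fun x => ?_) (fun x => ?_)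
  · convert key using 2
    have hq : 2 * Real.sin (√κ * (D / 2)) / Real.sin (√κ * D) =
        sKappa κ (D / 2) / (D / 2) / (sKappa κ D / D) := by
      rw [sKappa_of_pos hκ, sKappa_of_pos hκ]
      field_simp
    rw [← ENNReal.ofReal_div_of_pos hsin, ← ENNReal.ofReal_div_of_pos (by positivity),
      ← Real.div_rpow (by positivity) (by positivity),
      hq, ENNReal.ofReal_rpow_of_nonneg (by positivity) (by linarith)]
  · by_cases hx : x ∈ Set.Icc 0 D
    · rw [modelDensity_eq_mul hK hN hD hπ.le hx, mul_comm]
      refine mul_le_mul_of_nonneg_left ?_ (h₀.nonneg x)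
      exact Real.rpow_le_rpow (by positivity) (hbd x hx).1 (by linarith)
    · rw [modelDensity_of_notMem hD.le hx, modelDensity_of_notMem hD.le hx, mul_zero]
  · by_cases hx : x ∈ Set.Icc 0 D
    · rw [modelDensity_eq_mul hK hN hD hπ.le hx, mul_comm]
      refine mul_le_mul_of_nonneg_right ?_ (h₀.nonneg x)
      exact Real.rpow_le_rpow ((div_pos hpD hD).le.trans (hbd x hx).1) (hbd x hx).2 (by linarith)
    · rw [modelDensity_of_notMem hD.le hx, modelDensity_of_notMem hD.le hx, mul_zero]

/-! ### Distortion coefficients and the extremal diameter -/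

theorem bonnetMyersDiam_le_iff {K N D : ℝ} (hK : 0 < K) (hN : 1 < N) :
    bonnetMyersDiam K N ≤ (D : EReal) ↔ Real.pi ≤ √(K / (N - 1)) * D := by
  have hs : 0 < √(K / (N - 1)) := Real.sqrt_pos.2 (div_pos hK (by linarith))
  rw [bonnetMyersDiam, if_pos hK, EReal.coe_le_coe_iff, div_le_iff₀' hs]

theorem le_bonnetMyersDiam_iff {K N D : ℝ} (hK : 0 < K) (hN : 1 < N) :
    (D : EReal) ≤ bonnetMyersDiam K N ↔ √(K / (N - 1)) * D ≤ Real.pi := by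
  have hs : 0 < √(K / (N - 1)) := Real.sqrt_pos.2 (div_pos hK (by linarith))
  rw [bonnetMyersDiam, if_pos hK, EReal.coe_le_coe_iff, le_div_iff₀' hs]

theorem distortionCoeff_half_div {K N D : ℝ} (hK : 0 < K) (hN : 1 < N) (hD : 0 < D)
    (hπ : √(K / (N - 1)) * D ≤ Real.pi) :
    distortionCoeff K N (1 / 2) D / distortionCoeff 0 N (1 / 2) D =
      ENNReal.ofReal (2 * Real.sin (√(K / (N - 1)) * (D / 2))) /
        ENNReal.ofReal (Real.sin (√(K / (N - 1)) * D)) := by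
  have hκ : 0 < K / (N - 1) := div_pos hK (by linarith)
  have hs := Real.sqrt_pos.2 hκ
  have h0 : distortionCoeff 0 N (1 / 2) D = ENNReal.ofReal (1 / 2) := by
    rw [distortionCoeff, if_neg (by simp [bonnetMyersDiam]), zero_div, sKappa_zero, sKappa_zero,
      mul_div_cancel_right₀ _ hD.ne']
  rw [h0]
  rcases hπ.lt_or_eq with hlt | heq
  · have hsin : 0 < Real.sin (√(K / (N - 1)) * D) :=
      Real.sin_pos_of_pos_of_lt_pi (by positivity) hlt
    rw [distortionCoeff, if_neg (by rwa [bonnetMyersDiam_le_iff hK hN, not_le]),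
      ← ENNReal.ofReal_div_of_pos hsin, ← ENNReal.ofReal_div_of_pos (by norm_num),
      sKappa_of_pos hκ, sKappa_of_pos hκ, one_div_mul_eq_div 2 D]
    congr 1
    field_simp
  -- At the extremal diameter both sides are infinite: the coefficient by definition, the sine
  -- quotient as 2 / 0 in `ℝ≥0∞`.
  · have h2 : √(K / (N - 1)) * (D / 2) = Real.pi / 2 := by linarith
    rw [distortionCoeff, if_pos (by rw [bonnetMyersDiam_le_iff hK hN, heq]), heq, h2]
    simp [ENNReal.top_div, ENNReal.div_zero]

theorem corollary5p4 (K N D : ℝ) (hK : 0 < K) (hN : 1 < N) (hD : 0 < D)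
    (hDKN : (D : EReal) ≤ bonnetMyersDiam K N) :
    densityPoincareConstant (modelDensity 0 N D)
        ≤ densityPoincareConstant (modelDensity K N D) ∧
    densityPoincareConstant (modelDensity K N D)
        ≤ densityPoincareConstant (modelDensity 0 N D) *
          (distortionCoeff K N (1 / 2) D / distortionCoeff 0 N (1 / 2) D) ^ (N - 1) ∧
    densityPoincareConstant (modelDensity 0 N D) *
          (distortionCoeff K N (1 / 2) D / distortionCoeff 0 N (1 / 2) D) ^ (N - 1)
        = densityPoincareConstant (modelDensity 0 N D) *
          (ENNReal.ofReal (2 * Real.sin (√(K / (N - 1)) * (D / 2))) /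
            ENNReal.ofReal (Real.sin (√(K / (N - 1)) * D))) ^ (N - 1) := by
  have hπ := (le_bonnetMyersDiam_iff hK hN).1 hDKN
  rw [distortionCoeff_half_div hK hN hD hπ]
  refine ⟨densityPoincareConstant_modelDensity_zero_le hK hN hD hπ, ?_, rfl⟩
  rcases hπ.lt_or_eq with hlt | heq
  · exact densityPoincareConstant_modelDensity_le hK hN hD hlt
  · have h2 : √(K / (N - 1)) * (D / 2) = Real.pi / 2 := by linarith
    have htop : (ENNReal.ofReal (2 * Real.sin (√(K / (N - 1)) * (D / 2))) /
        ENNReal.ofReal (Real.sin (√(K / (N - 1)) * D))) ^ (N - 1) = ∞ := by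
      rw [h2, heq]
      simp [ENNReal.div_zero, ENNReal.top_rpow_of_pos (sub_pos.2 hN)]
    rw [htop, ENNReal.mul_top (densityPoincareConstant_modelDensity_zero_ne_zero hN hD)]
    exact le_top
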